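/- **Theorem 7.1 (limit points of geodesics).** Let $\mathcal A$ be a unital $C^*$-algebra and $\mathcal D=\{z\in\mathcal A:\|z\|<1\}$ its Poincaré disk. Embed $\mathcal D$ in the positive invertible elements of $M_2(\mathcal A)$ by $$\Phi(z)=\begin{pmatrix}2(1-z^*z)^{-1}-1 & -2(1-z^*z)^{-1}z^*\\ -2z(1-z^*z)^{-1} & 2z(1-z^*z)^{-1}z^*+1\end{pmatrix}.$$ A geodesic of $\mathcal D$ is a $C^2$ curve $\delta:\mathbb R\to\mathcal D$ such that $\gamma=\Phi\circ\delta$ is a geodesic of the natural connection $\frac{DX}{dt}=X'-\frac12(\gamma'\gamma^{-1}X+X\gamma^{-1}\gamma')$ of the space of positive invertible elements of $M_2(\mathcal A)$, i.e. $\frac{D\gamma'}{dt}=0$. Let $\pi:\mathcal A\to B(H)$ be the universal representation (the direct sum of the GNS representations of all states of $\mathcal A$), and let $\mathcal A^{**}=\pi(\mathcal A)''\subset B(H)$ be the bidual of $\mathcal A$, realised as its enveloping von Neumann algebra. Let $z\in\mathcal D$. Then: 1. there is a unique geodesic $\delta$ of $\mathcal D$ with $\delta(0)=0$ and $\delta(1)=z$;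 2. $z$ has a unique polar decomposition in $\mathcal A^{**}$: there is a unique partial isometry $\omega\in\mathcal A^{**}$ with $\pi(z)=\omega|\pi(z)|$ and $\ker\omega=\ker\pi(z)$; 3. for this geodesic $\delta$ and this partial isometry $\omega$, $$\mathrm{SOT}\text{-}\lim_{t\to+\infty}\pi(\delta(t))=\omega\qquad\text{and}\qquad \mathrm{SOT}\text{-}\lim_{t\to-\infty}\pi(\delta(t))=-\omega,$$ where SOT is the strong operator topology of $B(H)$. -/

import Mathlib

open Filter Topology
open scoped ENNReal ComplexOrder

/-! ### Geodesics of the Poincaré disk of a unital C⋆-algebra -/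

namespace PoincareDisk

section Geodesics

variable {A : Type*} [CStarAlgebra A] [PartialOrder A] [StarOrderedRing A]

/-- The embedding `Φ` of the disk `{z : ‖z‖ < 1}` into the positive invertible elements of the
C⋆-algebra `M₂(A)`:
`Φ z = [[2(1 - z*z)⁻¹ - 1, -2(1 - z*z)⁻¹z*], [-2z(1 - z*z)⁻¹, 2z(1 - z*z)⁻¹z* + 1]]`.
For `‖z‖ < 1` the element `1 - z*z` is invertible and `Ring.inverse` is its inverse. -/
noncomputable def embedding (z : A) : CStarMatrix (Fin 2) (Fin 2) A :=
  CStarMatrix.ofMatrix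
    !![(2 : ℝ) • Ring.inverse (1 - star z * z) - 1,
        -((2 : ℝ) • (Ring.inverse (1 - star z * z) * star z));
      -((2 : ℝ) • (z * Ring.inverse (1 - star z * z))),
        (2 : ℝ) • (z * Ring.inverse (1 - star z * z) * star z) + 1]

/-- The covariant derivative of the natural connection of the space of positive invertible
elements of a C⋆-algebra, for a vector field `X` along a curve `γ` of positive invertible elements:
`DX/dt = X' - (γ' γ⁻¹ X + X γ⁻¹ γ') / 2`. -/
noncomputable def covDeriv {B : Type*} [CStarAlgebra B] (γ X : ℝ → B) (t : ℝ) : B :=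
  deriv X t - (1 / 2 : ℝ) •
    (deriv γ t * Ring.inverse (γ t) * X t + X t * Ring.inverse (γ t) * deriv γ t)

/-- The geodesic equation in the space of positive invertible elements of a C⋆-algebra: the
covariant derivative of the velocity field vanishes, `Dγ'/dt = γ'' - γ' γ⁻¹ γ' = 0`. -/
def SatisfiesGeodesicEquation {B : Type*} [CStarAlgebra B] (γ : ℝ → B) : Prop :=
  ∀ t, covDeriv γ (deriv γ) t = 0

/-- A curve `δ : ℝ → A` is a geodesic of the disk `{z : ‖z‖ < 1}` if it stays in the disk, is of
class `C²`, and its image under the embedding of the disk into the positive invertible elements of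
`M₂(A)` satisfies the geodesic equation there.  (The image of the disk is totally geodesic, so
these are the geodesics of the connection which the disk inherits through the embedding.) -/
structure IsGeodesic (δ : ℝ → A) : Prop where
  norm_lt_one : ∀ t, ‖δ t‖ < 1
  contDiff : ContDiff ℝ 2 δ
  geodesic_equation : SatisfiesGeodesicEquation fun t => embedding (δ t)

end Geodesics

/-! ### The universal representation and the enveloping von Neumann algebra -/

section Universal

variable (A : Type*) [CStarAlgebra A] [PartialOrder A] [StarOrderedRing A]

/-- The states of a unital C⋆-algebra: the positive linear functionals `f` with `f 1 = 1`. -/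
abbrev States : Type _ := {f : A →ₚ[ℂ] ℂ // f 1 = 1}

/-- The Hilbert space of the universal representation: the Hilbert sum of the GNS spaces of all
states. -/
abbrev UniversalSpace : Type _ := lp (fun f : States A => f.1.GNS) 2

/-- The universal representation of a unital C⋆-algebra: the direct sum of the GNS representations
of all states. -/
noncomputable def universalRep : A →⋆ₐ[ℂ] (UniversalSpace A →L[ℂ] UniversalSpace A) where
  toFun a := lp.mapCLM 2 (fun f : States A => f.1.gnsStarAlgHom a) (norm_nonneg a)
    (fun f => NonUnitalStarAlgHom.norm_apply_le f.1.gnsStarAlgHom a)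
  map_one' := by
    ext x i
    simp only [lp.mapCLM_apply_coe, map_one]
    rfl
  map_mul' a b := by
    ext x i
    simp only [lp.mapCLM_apply_coe, map_mul]
    rfl
  map_zero' := by
    ext x i
    simp only [lp.mapCLM_apply_coe, map_zero]
    rfl
  map_add' a b := by
    ext x i
    simp only [lp.mapCLM_apply_coe, map_add]
    rfl
  commutes' r := by
    ext x i
    simp only [lp.mapCLM_apply_coe, AlgHomClass.commutes]
    rfl
  map_star' a := by
    refine (ContinuousLinearMap.eq_adjoint_iff _ _).mpr fun x y => ?_
    simp only [lp.inner_eq_tsum]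
    refine tsum_congr fun i => ?_
    simp only [lp.mapCLM_apply_coe, map_star, ContinuousLinearMap.star_eq_adjoint]
    exact ContinuousLinearMap.adjoint_inner_left _ _ _

/-- The bidual `A**` of a unital C⋆-algebra, realised as its enveloping von Neumann algebra: the
double commutant of the image of the universal representation. -/
noncomputable def enveloping : VonNeumannAlgebra (UniversalSpace A) where
  toStarSubalgebra := StarSubalgebra.centralizer ℂ (StarSubalgebra.centralizer ℂ
    (Set.range (universalRep A)) : Set (UniversalSpace A →L[ℂ] UniversalSpace A))
  centralizer_centralizer' := by
    simp

end Universal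

/-! ### Polar decomposition -/

/-- `ω` is the partial isometry of the polar decomposition of a bounded operator `T` on a Hilbert
space: `ω` is a partial isometry, `T = ω |T|` with `|T| = (T*T)^{1/2}`, and the initial space of
`ω` is the orthogonal complement of the kernel of `T`, i.e. `ω` and `T` have the same kernel. -/
structure IsPolarPart {H : Type*} [NormedAddCommGroup H] [InnerProductSpace ℂ H] [CompleteSpace H]
    (T ω : H →L[ℂ] H) : Prop where
  isPartialIsometry : ω * star ω * ω = ω
  eq_mul_abs : T = ω * CFC.abs T
  ker_eq : LinearMap.ker (ω : H →ₗ[ℂ] H) = LinearMap.ker (T : H →ₗ[ℂ] H)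

/-- Convergence in the strong operator topology of a family of bounded operators, along a filter. -/
def SOTTendsto {ι H : Type*} [NormedAddCommGroup H] [InnerProductSpace ℂ H]
    (T : ι → H →L[ℂ] H) (l : Filter ι) (S : H →L[ℂ] H) : Prop :=
  Tendsto (fun i => ContinuousLinearMap.toPointwiseConvergenceCLM ℂ (RingHom.id ℂ) H H (T i)) l
    (𝓝 (ContinuousLinearMap.toPointwiseConvergenceCLM ℂ (RingHom.id ℂ) H H S))

end PoincareDisk

/-!
Write `M z` for the selfadjoint matrix `[[0, z*], [z, 0]]`. Then `Φ z = (1 - M z)(1 + M z)⁻¹`, so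
`Φ z = exp (-2 M v)` if `M z = tanh (M v)`. The geodesics through `1` of the positive invertible
elements are the one-parameter groups `exp (t V)` with `V` selfadjoint, and `V` is the logarithm of
the value at `t = 1`. Hence the unique geodesic from `0` to `z` is `δ t = tanh (t artanh z)`, where
the odd functions `tanh` and `artanh` act on `A` through `M`. The scalar estimate
`|tanh (t y) |tanh y| - tanh y| ≤ 2 / t` gives `‖δ t |z| - z‖ ≤ 2 / t`, so in any representation `π`
the bounded operators `π (δ t)` converge to the partial isometry `ω` pointwise on the range of
`|π z|`. On the kernel of `π z` they vanish, because `δ t` is a left multiple of `z`, and the two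
subspaces together span a dense subspace.
-/

namespace PoincareDisk

/-! ### Geodesics of invertible elements -/

section InvertibleElements

variable {B : Type*} [CStarAlgebra B]

lemma ringInverse_exp (x : B) : Ring.inverse (NormedSpace.exp x) = NormedSpace.exp (-x) :=
  letI : NormedAlgebra ℚ B := NormedAlgebra.restrictScalars ℚ ℝ B
  Ring.inverse_exp x

lemma isUnit_exp (x : B) : IsUnit (NormedSpace.exp x) :=
  letI : NormedAlgebra ℚ B := NormedAlgebra.restrictScalars ℚ ℝ B
  NormedSpace.isUnit_exp x

lemma contDiff_exp_smul {n : WithTop ℕ∞} (V : B) :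
    ContDiff ℝ n fun t : ℝ => NormedSpace.exp (t • V) := by
  have hexp : ContDiff ℝ n (NormedSpace.exp : B → B) :=
    contDiff_iff_contDiffAt.mpr fun x => (NormedSpace.exp_analytic (𝕂 := ℝ) x).contDiffAt
  exact hexp.comp (contDiff_id.smul contDiff_const)

lemma satisfiesGeodesicEquation_iff {γ : ℝ → B} :
    SatisfiesGeodesicEquation γ ↔
      ∀ t, deriv (deriv γ) t = deriv γ t * Ring.inverse (γ t) * deriv γ t := by
  refine forall_congr' fun t => ?_
  rw [covDeriv, ← two_smul ℝ (deriv γ t * _ * _), smul_smul, one_div,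
    inv_mul_cancel₀ two_ne_zero, one_smul, sub_eq_zero]

lemma satisfiesGeodesicEquation_exp_smul (V : B) :
    SatisfiesGeodesicEquation fun t : ℝ => NormedSpace.exp (t • V) := by
  have hderiv : deriv (fun t : ℝ => NormedSpace.exp (t • V)) =
      fun t : ℝ => V * NormedSpace.exp (t • V) :=
    funext fun s => (hasDerivAt_exp_smul_const' V s).deriv
  refine satisfiesGeodesicEquation_iff.mpr fun t => ?_
  rw [hderiv, ((hasDerivAt_exp_smul_const' V t).const_mul V).deriv, mul_assoc V,
    Ring.mul_inverse_cancel _ (isUnit_exp _), mul_one]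

lemma eq_exp_smul_mul_of_hasDerivAt {γ : ℝ → B} {V : B} (hγ : ∀ t, HasDerivAt γ (V * γ t) t)
    (t : ℝ) : γ t = NormedSpace.exp (t • V) * γ 0 := by
  have hderiv (t : ℝ) : HasDerivAt (fun s : ℝ => NormedSpace.exp (s • -V) * γ s) 0 t := by
    refine ((hasDerivAt_exp_smul_const (-V) t).mul (hγ t)).congr_deriv ?_
    noncomm_ring
  have hconst : NormedSpace.exp (t • -V) * γ t = γ 0 := by
    simpa using is_const_of_deriv_eq_zero (fun t => (hderiv t).differentiableAt)
      (fun t => (hderiv t).deriv) t 0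
  rw [← hconst, smul_neg, ← ringInverse_exp, Ring.mul_inverse_cancel_left _ _ (isUnit_exp _)]

lemma hasDerivAt_ringInverse {γ : ℝ → B} {γ' : B} {t : ℝ} (hγ : HasDerivAt γ γ' t)
    (hu : IsUnit (γ t)) :
    HasDerivAt (fun s => Ring.inverse (γ s))
      (-(Ring.inverse (γ t) * γ' * Ring.inverse (γ t))) t := by
  obtain ⟨u, hu⟩ := hu
  have hinv := hasFDerivAt_ringInverse (𝕜 := ℝ) u
  rw [hu] at hinv
  refine (hinv.comp_hasDerivAt t hγ).congr_deriv ?_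
  simp [← hu]

namespace SatisfiesGeodesicEquation

-- The geodesic equation says that the logarithmic derivative `γ' γ⁻¹` is constant.
lemma deriv_mul_ringInverse {γ : ℝ → B} (hγ : SatisfiesGeodesicEquation γ)
    (hC : ContDiff ℝ 2 γ) (hu : ∀ t, IsUnit (γ t)) (t : ℝ) :
    deriv γ t * Ring.inverse (γ t) = deriv γ 0 * Ring.inverse (γ 0) := by
  have hderiv (t : ℝ) : HasDerivAt (fun s => deriv γ s * Ring.inverse (γ s)) 0 t := by
    have hγ' : HasDerivAt γ (deriv γ t) t := (hC.differentiable two_ne_zero t).hasDerivAt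
    have hγ'' : HasDerivAt (deriv γ) (deriv γ t * Ring.inverse (γ t) * deriv γ t) t := by
      rw [← satisfiesGeodesicEquation_iff.mp hγ t]
      exact (hC.differentiable_deriv_two t).hasDerivAt
    refine (hγ''.mul (hasDerivAt_ringInverse hγ' (hu t))).congr_deriv ?_
    noncomm_ring
  exact is_const_of_deriv_eq_zero (fun t => (hderiv t).differentiableAt)
    (fun t => (hderiv t).deriv) t 0

lemma eq_exp_smul_mul {γ : ℝ → B} (hγ : SatisfiesGeodesicEquation γ) (hC : ContDiff ℝ 2 γ)
    (hu : ∀ t, IsUnit (γ t)) (t : ℝ) :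
    γ t = NormedSpace.exp (t • (deriv γ 0 * Ring.inverse (γ 0))) * γ 0 := by
  refine eq_exp_smul_mul_of_hasDerivAt (fun s => ?_) t
  rw [← hγ.deriv_mul_ringInverse hC hu s, mul_assoc, Ring.inverse_mul_cancel _ (hu s), mul_one]
  exact (hC.differentiable two_ne_zero s).hasDerivAt

lemma exists_eq_exp_smul {γ : ℝ → B} (hγ : SatisfiesGeodesicEquation γ) (hC : ContDiff ℝ 2 γ)
    (hu : ∀ t, IsUnit (γ t)) (hs : ∀ t, IsSelfAdjoint (γ t)) (h0 : γ 0 = 1) :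
    ∃ V : B, IsSelfAdjoint V ∧ γ = fun t => NormedSpace.exp (t • V) := by
  refine ⟨deriv γ 0, ?_, funext fun t => by simpa [h0] using hγ.eq_exp_smul_mul hC hu t⟩
  have hγ' : HasDerivAt γ (deriv γ 0) 0 := (hC.differentiable two_ne_zero 0).hasDerivAt
  have hstar : (fun t => star (γ t)) = γ := funext fun t => (hs t).star_eq
  exact (hstar ▸ hγ'.star).unique hγ'

lemma eq_of_eq_one {γ₁ γ₂ : ℝ → B}
    (h₁ : SatisfiesGeodesicEquation γ₁) (h₂ : SatisfiesGeodesicEquation γ₂)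
    (hC₁ : ContDiff ℝ 2 γ₁) (hC₂ : ContDiff ℝ 2 γ₂)
    (hu₁ : ∀ t, IsUnit (γ₁ t)) (hu₂ : ∀ t, IsUnit (γ₂ t))
    (hs₁ : ∀ t, IsSelfAdjoint (γ₁ t)) (hs₂ : ∀ t, IsSelfAdjoint (γ₂ t))
    (h0₁ : γ₁ 0 = 1) (h0₂ : γ₂ 0 = 1) (h : γ₁ 1 = γ₂ 1) : γ₁ = γ₂ := by
  obtain ⟨V₁, hV₁, rfl⟩ := h₁.exists_eq_exp_smul hC₁ hu₁ hs₁ h0₁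
  obtain ⟨V₂, hV₂, rfl⟩ := h₂.exists_eq_exp_smul hC₂ hu₂ hs₂ h0₂
  have hexp : NormedSpace.exp V₁ = NormedSpace.exp V₂ := by simpa using h
  rw [← CFC.log_exp V₁ hV₁, hexp, CFC.log_exp V₂ hV₂]

end SatisfiesGeodesicEquation

end InvertibleElements

/-! ### The Cayley transform -/

section Cayley

section Ring

variable {R : Type*} [Ring R]

/-- The Cayley transform `(1 - x)(1 + x)⁻¹`, for `x` with `1 + x` invertible. It carries the
off-diagonal matrices `[[0, z*], [z, 0]]`, `‖z‖ < 1`, to the image of the disk. -/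
noncomputable def cayley (x : R) : R := (1 - x) * Ring.inverse (1 + x)

lemma eq_cayley_iff {x y : R} (hx : IsUnit (1 + x)) :
    y = cayley x ↔ (1 + y) * (1 + x) = 2 := by
  have hmul : (1 + y) * (1 + x) = 2 ↔ y * (1 + x) = 1 - x := by
    rw [add_mul, one_mul, ← eq_sub_iff_add_eq']
    exact Eq.congr_right (by rw [← one_add_one_eq_two]; abel)
  rw [hmul, cayley, Ring.eq_mul_inverse_iff_mul_eq _ _ _ hx]

lemma one_add_cayley {x : R} (hx : IsUnit (1 + x)) :
    1 + cayley x = 2 * Ring.inverse (1 + x) :=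
  (Ring.eq_mul_inverse_iff_mul_eq _ _ _ hx).mpr ((eq_cayley_iff hx).mp rfl)

lemma isUnit_one_add_cayley {x : R} (h2 : IsUnit (2 : R)) (hx : IsUnit (1 + x)) :
    IsUnit (1 + cayley x) :=
  one_add_cayley hx ▸ h2.mul (isUnit_ringInverse.mpr hx)

lemma isUnit_cayley {x : R} (hx : IsUnit (1 + x)) (hx' : IsUnit (1 - x)) : IsUnit (cayley x) :=
  hx'.mul (isUnit_ringInverse.mpr hx)

lemma cayley_cayley {x : R} (h2 : IsUnit (2 : R)) (hx : IsUnit (1 + x)) :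
    cayley (cayley x) = x := by
  refine ((eq_cayley_iff (isUnit_one_add_cayley h2 hx)).mpr ?_).symm
  rw [one_add_cayley hx, two_mul, mul_add, Ring.mul_inverse_cancel _ hx, one_add_one_eq_two]

lemma isSelfAdjoint_cayley [StarRing R] {x : R} (hu : IsUnit (1 + x)) (hx : IsSelfAdjoint x) :
    IsSelfAdjoint (cayley x) := by
  have hinv : IsSelfAdjoint (Ring.inverse (1 + x)) := ((IsSelfAdjoint.one R).add hx).ringInverse
  rw [eq_sub_of_add_eq' (one_add_cayley hu), two_mul]
  exact (hinv.add hinv).sub (.one R)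

end Ring

lemma contDiff_cayley {E B : Type*} [NormedAddCommGroup E] [NormedSpace ℝ E] [NormedRing B]
    [NormedAlgebra ℝ B] [CompleteSpace B] {n : WithTop ℕ∞} {f : E → B} (hf : ContDiff ℝ n f)
    (hu : ∀ x, IsUnit (1 + f x)) : ContDiff ℝ n fun x => cayley (f x) := by
  refine (contDiff_const.sub hf).mul (contDiff_iff_contDiffAt.mpr fun x => ?_)
  obtain ⟨u, hu⟩ := hu x
  exact ContDiffAt.comp x (hu ▸ contDiffAt_ringInverse ℝ u) (contDiff_const.add hf).contDiffAt

end Cayley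

/-! ### The hyperbolic tangent -/

section Tanh

lemma differentiable_tanh : Differentiable ℝ Real.tanh := by
  rw [funext Real.tanh_eq_sinh_div_cosh]
  exact Real.differentiable_sinh.fun_div Real.differentiable_cosh fun x => (Real.cosh_pos x).ne'

lemma one_add_exp_mul_one_add_tanh (u : ℝ) :
    (1 + Real.exp (-2 * u)) * (1 + Real.tanh u) = 2 := by
  rw [Real.tanh_eq, show -2 * u = -u + -u by ring, Real.exp_add, Real.exp_neg]
  have := Real.exp_pos u
  field_simp
  ring

lemma tanh_nonneg {u : ℝ} (hu : 0 ≤ u) : 0 ≤ Real.tanh u := by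
  rw [Real.tanh_eq_sinh_div_cosh]
  exact div_nonneg (Real.sinh_nonneg_iff.mpr hu) (Real.cosh_pos u).le

lemma tanh_le_two_mul {u : ℝ} (hu : 0 ≤ u) : Real.tanh u ≤ 2 * u := by
  have hexp := Real.add_one_le_exp (-2 * u)
  have htanh := mul_nonneg (Real.exp_pos (-2 * u)).le (tanh_nonneg hu)
  linarith [one_add_exp_mul_one_add_tanh u]

lemma one_sub_tanh_mul_le {u : ℝ} (hu : 0 ≤ u) : (1 - Real.tanh u) * u ≤ 1 := by
  have hinv : Real.exp (-2 * u) * Real.exp (2 * u) = 1 := by rw [← Real.exp_add]; simp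
  have hexp : 1 - Real.tanh u ≤ 2 * Real.exp (-2 * u) := by
    have htanh := mul_le_mul_of_nonneg_left (Real.tanh_lt_one u).le (Real.exp_pos (-2 * u)).le
    linarith [one_add_exp_mul_one_add_tanh u]
  calc (1 - Real.tanh u) * u ≤ 2 * Real.exp (-2 * u) * u := by gcongr
    _ = Real.exp (-2 * u) * (2 * u) := by ring
    _ ≤ Real.exp (-2 * u) * Real.exp (2 * u) := by gcongr; linarith [Real.add_one_le_exp (2 * u)]
    _ = 1 := hinv

lemma abs_tanh_mul_abs_tanh_sub_le {t : ℝ} (ht : 0 < t) (y : ℝ) :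
    |Real.tanh (t * y) * |Real.tanh y| - Real.tanh y| ≤ 2 / t := by
  wlog hy : 0 ≤ y generalizing y
  · have h := this (-y) (by linarith)
    rw [mul_neg, Real.tanh_neg, Real.tanh_neg, abs_neg] at h
    rwa [← abs_neg, neg_sub', ← neg_mul]
  have hlt : 0 ≤ 1 - Real.tanh (t * y) := sub_nonneg.mpr (Real.tanh_lt_one _).le
  calc |Real.tanh (t * y) * |Real.tanh y| - Real.tanh y|
      = (1 - Real.tanh (t * y)) * Real.tanh y := by
        rw [abs_of_nonneg (tanh_nonneg hy), ← abs_neg, neg_sub, ← one_sub_mul,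
          abs_of_nonneg (mul_nonneg hlt (tanh_nonneg hy))]
    _ ≤ (1 - Real.tanh (t * y)) * (2 * y) := by gcongr; exact tanh_le_two_mul hy
    _ = 2 / t * ((1 - Real.tanh (t * y)) * (t * y)) := by field_simp
    _ ≤ 2 / t * 1 := by gcongr; exact one_sub_tanh_mul_le (by positivity)
    _ = 2 / t := mul_one _

lemma differentiableAt_artanh {x : ℝ} (hx : x ∈ Set.Ioo (-1) 1) :
    DifferentiableAt ℝ Real.artanh x := by
  have heq : Real.artanh =ᶠ[𝓝 x] fun y => 1 / 2 * Real.log ((1 + y) / (1 - y)) := by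
    filter_upwards [Ioo_mem_nhds hx.1 hx.2] with y hy
    exact Real.artanh_eq_half_log (Set.Ioo_subset_Icc_self hy)
  refine DifferentiableAt.congr_of_eventuallyEq ?_ heq
  have h₁ : 1 + x ≠ 0 := by linarith [hx.1]
  have h₂ : 1 - x ≠ 0 := by linarith [hx.2]
  fun_prop (disch := first | assumption | exact div_ne_zero h₁ h₂)

lemma artanh_neg_eq_neg (x : ℝ) : Real.artanh (-x) = -Real.artanh x := by
  rw [Real.artanh, Real.artanh, ← Real.log_inv, ← Real.sqrt_inv, inv_div, sub_neg_eq_add,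
    ← sub_eq_add_neg]

end Tanh

/-! ### Tanh and the Cayley transform in a C⋆-algebra -/

section CStarAlgebra

variable {B : Type*} [CStarAlgebra B]

lemma isUnit_one_add_of_norm_lt_one {x : B} (hx : ‖x‖ < 1) : IsUnit (1 + x) := by
  simpa using isUnit_one_sub_of_norm_lt_one (x := -x) (by rwa [norm_neg])

lemma isUnit_two : IsUnit (2 : B) :=
  map_ofNat (algebraMap ℂ B) 2 ▸ (IsUnit.mk0 (2 : ℂ) two_ne_zero).map (algebraMap ℂ B)

lemma norm_cfc_tanh_lt_one (a : B) : ‖cfc Real.tanh a‖ < 1 :=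
  norm_cfc_lt one_pos fun x _ => Real.abs_tanh_lt_one x

lemma cayley_cfc_tanh {a : B} (ha : IsSelfAdjoint a) :
    cayley (cfc Real.tanh a) = NormedSpace.exp ((-2 : ℝ) • a) := by
  have htanh : ContinuousOn Real.tanh (spectrum ℝ a) := differentiable_tanh.continuous.continuousOn
  have hexp : ContinuousOn (fun u => Real.exp (-2 * u)) (spectrum ℝ a) := by fun_prop
  refine ((eq_cayley_iff (isUnit_one_add_of_norm_lt_one (norm_cfc_tanh_lt_one a))).mpr ?_).symm
  have hcfc : NormedSpace.exp ((-2 : ℝ) • a) = cfc (fun u => Real.exp (-2 * u)) a := by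
    rw [cfc_comp_const_mul (-2 : ℝ) Real.exp a, CFC.real_exp_eq_normedSpace_exp]
  rw [hcfc, ← cfc_const_one ℝ a, ← cfc_add .., ← cfc_add .., ← cfc_mul ..,
    funext one_add_exp_mul_one_add_tanh]
  exact (cfc_const 2 a).trans (map_ofNat _ 2)

end CStarAlgebra

/-! ### Off-diagonal matrices and the embedding of the disk -/

/-- The C⋆-algebra `M₂(A)`, as a type which carries only its structure of a C⋆-algebra: real
scalars act on it as complex scalars, whereas on `CStarMatrix` they also act entrywise. -/
def MatrixTwo (A : Type*) : Type _ := CStarMatrix (Fin 2) (Fin 2) A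

section MatrixTwo

namespace MatrixTwo

section Entries

variable {A : Type*}

/-- The matrix `[[a, b], [c, d]]`. -/
def mk (a b c d : A) : MatrixTwo A := CStarMatrix.ofMatrix !![a, b; c, d]

/-- The entry of a matrix in row `i` and column `j`. -/
def entry (M : MatrixTwo A) (i j : Fin 2) : A := (M : CStarMatrix (Fin 2) (Fin 2) A) i j

lemma ext {M N : MatrixTwo A} (h : ∀ i j, M.entry i j = N.entry i j) : M = N := CStarMatrix.ext h

@[simp] lemma entry_mk (a b c d : A) (i j : Fin 2) : (mk a b c d).entry i j = !![a, b; c, d] i j :=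
  rfl

end Entries

variable {A : Type*} [CStarAlgebra A] [PartialOrder A] [StarOrderedRing A]

noncomputable instance : CStarAlgebra (MatrixTwo A) :=
  inferInstanceAs (CStarAlgebra (CStarMatrix (Fin 2) (Fin 2) A))

noncomputable instance : PartialOrder (MatrixTwo A) :=
  inferInstanceAs (PartialOrder (CStarMatrix (Fin 2) (Fin 2) A))

instance : StarOrderedRing (MatrixTwo A) :=
  inferInstanceAs (StarOrderedRing (CStarMatrix (Fin 2) (Fin 2) A))

@[simp] lemma entry_add (M N : MatrixTwo A) (i j : Fin 2) :
    (M + N).entry i j = M.entry i j + N.entry i j := rfl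

@[simp] lemma entry_sub (M N : MatrixTwo A) (i j : Fin 2) :
    (M - N).entry i j = M.entry i j - N.entry i j := rfl

@[simp] lemma entry_neg (M : MatrixTwo A) (i j : Fin 2) : (-M).entry i j = -M.entry i j := rfl

@[simp] lemma entry_smul (r : ℝ) (M : MatrixTwo A) (i j : Fin 2) :
    (r • M).entry i j = r • M.entry i j := rfl

lemma entry_mul (M N : MatrixTwo A) (i j : Fin 2) :
    (M * N).entry i j = M.entry i 0 * N.entry 0 j + M.entry i 1 * N.entry 1 j := by
  refine (CStarMatrix.mul_apply (M := M) (N := N)).trans ?_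
  rw [Fin.sum_univ_two]
  rfl

lemma mk_add_mk (a b c d a' b' c' d' : A) :
    mk a b c d + mk a' b' c' d' = mk (a + a') (b + b') (c + c') (d + d') :=
  ext fun i j => by fin_cases i <;> fin_cases j <;> rfl

lemma one_eq_mk : (1 : MatrixTwo A) = mk 1 0 0 1 :=
  ext fun i j => by fin_cases i <;> fin_cases j <;> rfl

lemma mk_mul_mk (a b c d a' b' c' d' : A) :
    mk a b c d * mk a' b' c' d' =
      mk (a * a' + b * c') (a * b' + b * d') (c * a' + d * c') (c * b' + d * d') :=
  ext fun i j => by fin_cases i <;> fin_cases j <;> simp [entry_mul]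

@[simp] lemma entry_star (M : MatrixTwo A) (i j : Fin 2) :
    (star M).entry i j = star (M.entry j i) := rfl

lemma norm_entry_le (M : MatrixTwo A) (i j : Fin 2) : ‖M.entry i j‖ ≤ ‖M‖ :=
  CStarMatrix.norm_entry_le_norm (M := M)

/-- The lower left entry of a matrix, as a continuous linear map. -/
noncomputable def lowerLeft : MatrixTwo A →L[ℝ] A :=
  LinearMap.mkContinuous
    { toFun := fun M => M.entry 1 0, map_add' := fun _ _ => rfl, map_smul' := fun _ _ => rfl } 1
    fun M => (norm_entry_le M 1 0).trans_eq (one_mul _).symm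

/-- The diagonal matrices, as a homomorphic image of `A × A`. -/
noncomputable def diag : A × A →⋆ₐ[ℂ] MatrixTwo A where
  toFun p := mk p.1 0 0 p.2
  map_one' := one_eq_mk.symm
  map_mul' p q := by simp [mk_mul_mk]
  map_zero' := ext fun i j => by fin_cases i <;> fin_cases j <;> rfl
  map_add' p q := by rw [mk_add_mk, add_zero]; rfl
  commutes' r := by
    rw [Algebra.algebraMap_eq_smul_one, Algebra.algebraMap_eq_smul_one, one_eq_mk]
    exact ext fun i j => by fin_cases i <;> fin_cases j <;> first | rfl | exact (smul_zero r).symm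
  map_star' p := ext fun i j => by fin_cases i <;> fin_cases j <;> simp

lemma diag_apply (p : A × A) : diag p = mk p.1 0 0 p.2 := rfl

lemma isSelfAdjoint_mk_off_diag (z : A) : IsSelfAdjoint (mk 0 (star z) z 0) :=
  ext fun i j => by fin_cases i <;> fin_cases j <;> simp

lemma mk_off_diag_mul_self (z : A) :
    mk 0 (star z) z 0 * mk 0 (star z) z 0 = diag (star z * z, z * star z) := by
  simp [mk_mul_mk, diag_apply]

lemma norm_mk_off_diag_le (z : A) : ‖mk 0 (star z) z 0‖ ≤ ‖z‖ := by
  refine le_of_sq_le_sq ?_ (norm_nonneg z)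
  have hdiag := NonUnitalStarAlgHom.norm_apply_le (diag (A := A)) (star z * z, z * star z)
  rw [← mk_off_diag_mul_self, Prod.norm_mk, CStarRing.norm_star_mul_self,
    CStarRing.norm_self_mul_star, max_self] at hdiag
  rw [sq ‖z‖, ← (isSelfAdjoint_mk_off_diag z).norm_mul_self]
  exact hdiag

end MatrixTwo

open MatrixTwo

section Embedding

variable {A : Type*} [CStarAlgebra A]

/-- The embedding of the disk, with values in `MatrixTwo A`. -/
noncomputable def diskEmbedding (z : A) : MatrixTwo A := embedding z

lemma diskEmbedding_apply (z : A) : diskEmbedding z =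
    mk ((2 : ℝ) • Ring.inverse (1 - star z * z) - 1)
      (-((2 : ℝ) • (Ring.inverse (1 - star z * z) * star z)))
      (-((2 : ℝ) • (z * Ring.inverse (1 - star z * z))))
      ((2 : ℝ) • (z * Ring.inverse (1 - star z * z) * star z) + 1) := rfl

lemma isUnit_one_sub_star_mul_self {z : A} (hz : ‖z‖ < 1) : IsUnit (1 - star z * z) :=
  isUnit_one_sub_of_norm_lt_one <| by
    rw [CStarRing.norm_star_mul_self]
    exact mul_lt_one_of_nonneg_of_lt_one_left (norm_nonneg z) hz hz.le

end Embedding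

variable {A : Type*} [CStarAlgebra A] [PartialOrder A] [StarOrderedRing A]

/-- The selfadjoint matrix `[[0, z*], [z, 0]]`. -/
noncomputable def offDiag : A →L[ℝ] MatrixTwo A :=
  LinearMap.mkContinuous
    { toFun := fun z => mk 0 (star z) z 0
      map_add' := fun x y => MatrixTwo.ext fun i j => by
        fin_cases i <;> fin_cases j <;> simp
      map_smul' := fun r x => MatrixTwo.ext fun i j => by
        fin_cases i <;> fin_cases j <;> simp } 1
    fun z => (norm_mk_off_diag_le z).trans_eq (one_mul _).symm

lemma offDiag_apply (z : A) : offDiag z = mk 0 (star z) z 0 := rfl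

@[simp] lemma entry_offDiag (z : A) : (offDiag z).entry 1 0 = z := rfl

lemma isSelfAdjoint_offDiag (z : A) : IsSelfAdjoint (offDiag z) := isSelfAdjoint_mk_off_diag z

lemma norm_offDiag_lt_one {z : A} (hz : ‖z‖ < 1) : ‖offDiag z‖ < 1 :=
  (norm_mk_off_diag_le z).trans_lt hz

lemma offDiag_injective : Function.Injective (offDiag : A → MatrixTwo A) := fun _ _ h =>
  congrArg (fun M => M.entry 1 0) h

lemma abs_offDiag (z : A) : CFC.abs (offDiag z) = diag (CFC.abs z, CFC.abs (star z)) := by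
  refine CFC.sqrt_unique ?_ <| map_nonneg diag <|
    Prod.mk_le_mk.mpr ⟨CFC.abs_nonneg z, CFC.abs_nonneg (star z)⟩
  rw [← map_mul, Prod.mk_mul_mk, CFC.abs_mul_abs, CFC.abs_mul_abs, star_star,
    (isSelfAdjoint_offDiag z).star_eq]
  exact (mk_off_diag_mul_self z).symm

lemma one_add_diskEmbedding_mul {z : A} (hz : ‖z‖ < 1) :
    (1 + diskEmbedding z) * (1 + offDiag z) = 2 := by
  have h := Ring.inverse_mul_cancel _ (isUnit_one_sub_star_mul_self hz)
  rw [mul_sub, mul_one] at h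
  rw [← one_add_one_eq_two, diskEmbedding_apply, offDiag_apply, one_eq_mk, mk_add_mk, mk_add_mk,
    mk_mul_mk, mk_add_mk]
  generalize Ring.inverse (1 - star z * z) = D at *
  simp only [add_sub_cancel, zero_add, add_zero, mul_one, neg_mul, smul_mul_assoc]
  congr 1
  · rw [← h, mul_assoc]
    module
  · exact add_neg_cancel _
  · have hz := congrArg (z * ·) h
    simp only [mul_sub, mul_one] at hz
    simp only [add_mul, smul_mul_assoc, mul_assoc, one_mul]
    linear_combination (norm := module) (-2 : ℝ) • hz
  · module

lemma diskEmbedding_eq_cayley {z : A} (hz : ‖z‖ < 1) : diskEmbedding z = cayley (offDiag z) :=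
  (eq_cayley_iff (isUnit_one_add_of_norm_lt_one (norm_offDiag_lt_one hz))).mpr
    (one_add_diskEmbedding_mul hz)

lemma cayley_diskEmbedding {z : A} (hz : ‖z‖ < 1) : cayley (diskEmbedding z) = offDiag z := by
  rw [diskEmbedding_eq_cayley hz,
    cayley_cayley isUnit_two (isUnit_one_add_of_norm_lt_one (norm_offDiag_lt_one hz))]

lemma isUnit_diskEmbedding {z : A} (hz : ‖z‖ < 1) : IsUnit (diskEmbedding z) := by
  rw [diskEmbedding_eq_cayley hz]
  exact isUnit_cayley (isUnit_one_add_of_norm_lt_one (norm_offDiag_lt_one hz))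
    (isUnit_one_sub_of_norm_lt_one (norm_offDiag_lt_one hz))

lemma isSelfAdjoint_diskEmbedding {z : A} (hz : ‖z‖ < 1) : IsSelfAdjoint (diskEmbedding z) := by
  rw [diskEmbedding_eq_cayley hz]
  exact isSelfAdjoint_cayley (isUnit_one_add_of_norm_lt_one (norm_offDiag_lt_one hz))
    (isSelfAdjoint_offDiag z)

lemma diskEmbedding_zero : diskEmbedding (0 : A) = 1 := by
  rw [diskEmbedding_eq_cayley (by simp), map_zero, cayley, sub_zero, add_zero, Ring.inverse_one,
    one_mul]

lemma diskEmbedding_injOn : Set.InjOn (diskEmbedding (A := A)) {z | ‖z‖ < 1} :=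
  fun z hz w hw h => offDiag_injective <| by
    rw [← cayley_diskEmbedding hz, ← cayley_diskEmbedding hw, h]

lemma contDiff_diskEmbedding_comp {n : WithTop ℕ∞} {δ : ℝ → A} (hδ : ContDiff ℝ n δ)
    (h : ∀ t, ‖δ t‖ < 1) : ContDiff ℝ n fun t => diskEmbedding (δ t) := by
  simp only [fun t => diskEmbedding_eq_cayley (h t)]
  exact contDiff_cayley (hδ.continuousLinearMap_comp offDiag) fun t =>
    isUnit_one_add_of_norm_lt_one (norm_offDiag_lt_one (h t))

lemma IsGeodesic.eq_of_eq_zero {δ₁ δ₂ : ℝ → A} (h₁ : IsGeodesic δ₁) (h₂ : IsGeodesic δ₂)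
    (h0₁ : δ₁ 0 = 0) (h0₂ : δ₂ 0 = 0) (h : δ₁ 1 = δ₂ 1) : δ₁ = δ₂ := by
  have heq : (fun t => diskEmbedding (δ₁ t)) = fun t => diskEmbedding (δ₂ t) :=
    SatisfiesGeodesicEquation.eq_of_eq_one (B := MatrixTwo A)
      h₁.geodesic_equation h₂.geodesic_equation
      (contDiff_diskEmbedding_comp h₁.contDiff h₁.norm_lt_one)
      (contDiff_diskEmbedding_comp h₂.contDiff h₂.norm_lt_one)
      (fun t => isUnit_diskEmbedding (h₁.norm_lt_one t))
      (fun t => isUnit_diskEmbedding (h₂.norm_lt_one t))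
      (fun t => isSelfAdjoint_diskEmbedding (h₁.norm_lt_one t))
      (fun t => isSelfAdjoint_diskEmbedding (h₂.norm_lt_one t))
      (by rw [h0₁, diskEmbedding_zero]) (by rw [h0₂, diskEmbedding_zero]) (by rw [h])
  exact funext fun t =>
    diskEmbedding_injOn (h₁.norm_lt_one t) (h₂.norm_lt_one t) (congrFun heq t)

end MatrixTwo

/-! ### Odd functional calculus -/

section OddCalculus

section CStarAlgebra

variable {B : Type*} [CStarAlgebra B]

lemma spectrum_subset_Ioo_of_norm_lt_one {a : B} (ha : ‖a‖ < 1) :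
    spectrum ℝ a ⊆ Set.Ioo (-1) 1 := fun x hx => by
  cases subsingleton_or_nontrivial B
  · simp [spectrum.of_subsingleton] at hx
  · exact abs_lt.mp ((spectrum.norm_le_norm_of_mem hx).trans_lt ha)

lemma cfc_neg_of_odd {f : ℝ → ℝ} (hodd : ∀ x, f (-x) = -f x) {a : B}
    (hf : ContinuousOn f (spectrum ℝ a)) (ha : IsSelfAdjoint a) : cfc f (-a) = -cfc f a := by
  have hf' : ContinuousOn f ((fun x => -x) '' spectrum ℝ a) := by
    rintro _ ⟨x, hx, rfl⟩
    have h := ((hf x hx).neg.comp_of_eq (f := Neg.neg) (s := Neg.neg '' spectrum ℝ a)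
      continuous_neg.continuousWithinAt ?_ (neg_neg x))
    · exact h.congr (fun y _ => by simp [hodd]) (by simp [hodd])
    · rintro _ ⟨y, hy, rfl⟩
      simpa using hy
  rw [← cfc_comp_neg f a hf', ← cfc_neg]
  simp only [hodd]

lemma unitary_conj_cfc_of_odd {f : ℝ → ℝ} (hodd : ∀ x, f (-x) = -f x) {a : B}
    (ha : IsSelfAdjoint a) (u : unitary B) (hu : Unitary.conjStarAlgAut ℂ B u a = -a) :
    Unitary.conjStarAlgAut ℂ B u (cfc f a) = -cfc f a := by
  by_cases hf : ContinuousOn f (spectrum ℝ a)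
  · rw [StarAlgHomClass.map_cfc _ f a hf (StarAlgEquiv.isometry _).continuous ha (hu ▸ ha.neg),
      hu, cfc_neg_of_odd hodd hf ha]
  · rw [cfc_apply_of_not_continuousOn a hf, map_zero, neg_zero]

end CStarAlgebra

variable {A : Type*} [CStarAlgebra A] [PartialOrder A] [StarOrderedRing A]

open MatrixTwo

/-- The unitary matrix `[[1, 0], [0, -1]]`. Off-diagonal matrices are the ones which it
conjugates to their negatives. -/
noncomputable def signature (A : Type*) [CStarAlgebra A] [PartialOrder A] [StarOrderedRing A] :
    unitary (MatrixTwo A) :=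
  ⟨diag (1, -1), Unitary.map_mem diag (by simp [Unitary.mem_iff, Prod.ext_iff])⟩

lemma conj_signature (M : MatrixTwo A) :
    Unitary.conjStarAlgAut ℂ _ (signature A) M =
      mk (M.entry 0 0) (-M.entry 0 1) (-M.entry 1 0) (M.entry 1 1) := by
  rw [Unitary.conjStarAlgAut_apply]
  change mk 1 0 0 (-1) * M * star (mk 1 0 0 (-1)) = _
  refine MatrixTwo.ext fun i j => ?_
  fin_cases i <;> fin_cases j <;> simp [entry_mul]

lemma conj_signature_offDiag (z : A) :
    Unitary.conjStarAlgAut ℂ _ (signature A) (offDiag z) = -offDiag z := by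
  rw [conj_signature]
  refine MatrixTwo.ext fun i j => ?_
  fin_cases i <;> fin_cases j <;> simp [offDiag_apply]

lemma offDiag_entry_of_conj_signature {M : MatrixTwo A} (hM : IsSelfAdjoint M)
    (h : Unitary.conjStarAlgAut ℂ _ (signature A) M = -M) : offDiag (M.entry 1 0) = M := by
  have : IsAddTorsionFree A := .of_isTorsionFree ℝ A
  rw [conj_signature] at h
  have h00 : M.entry 0 0 = 0 := self_eq_neg.mp (congrArg (fun M => M.entry 0 0) h)
  have h11 : M.entry 1 1 = 0 := self_eq_neg.mp (congrArg (fun M => M.entry 1 1) h)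
  have h01 : star (M.entry 1 0) = M.entry 0 1 := congrArg (fun M => M.entry 0 1) hM.star_eq
  refine MatrixTwo.ext fun i j => ?_
  fin_cases i <;> fin_cases j <;> simp [offDiag_apply, h00, h01, h11]

/-- The functional calculus of an arbitrary element `z` with an odd function `f`, through the
selfadjoint matrix `[[0, z*], [z, 0]]`. If `z = ω|z|` is the polar decomposition, then this is
`ω f(|z|)`. -/
noncomputable def oddCfc (f : ℝ → ℝ) (z : A) : A := (cfc f (offDiag z)).entry 1 0

lemma offDiag_oddCfc {f : ℝ → ℝ} (hodd : ∀ x, f (-x) = -f x) (z : A) :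
    offDiag (oddCfc f z) = cfc f (offDiag z) :=
  offDiag_entry_of_conj_signature (cfc_predicate f _) <|
    unitary_conj_cfc_of_odd hodd (isSelfAdjoint_offDiag z) _ (conj_signature_offDiag z)

lemma oddCfc_oddCfc {f g : ℝ → ℝ} (hodd : ∀ x, f (-x) = -f x) {z : A}
    (hg : ContinuousOn g (f '' spectrum ℝ (offDiag z)))
    (hf : ContinuousOn f (spectrum ℝ (offDiag z))) :
    oddCfc g (oddCfc f z) = oddCfc (g ∘ f) z := by
  rw [oddCfc, offDiag_oddCfc hodd, ← cfc_comp g f _ (isSelfAdjoint_offDiag z) hg hf,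
    oddCfc]

lemma oddCfc_neg {f : ℝ → ℝ} (hodd : ∀ x, f (-x) = -f x) {z : A}
    (hf : ContinuousOn f (spectrum ℝ (offDiag z))) : oddCfc f (-z) = -oddCfc f z := by
  rw [oddCfc, map_neg, cfc_neg_of_odd hodd hf (isSelfAdjoint_offDiag z), entry_neg, oddCfc]

lemma oddCfc_eq_self {f : ℝ → ℝ} {z : A} (hf : (spectrum ℝ (offDiag z)).EqOn f id) :
    oddCfc f z = z := by
  rw [oddCfc, cfc_congr hf, cfc_id ℝ _ (isSelfAdjoint_offDiag z), entry_offDiag]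

lemma exists_oddCfc_eq_mul {f : ℝ → ℝ} {s : Set ℝ} {z : A} (hs : s ∈ 𝓝 0)
    (hz : spectrum ℝ (offDiag z) ⊆ s) (hf : ContinuousOn f s) (hf' : DifferentiableAt ℝ f 0)
    (h0 : f 0 = 0) : ∃ a : A, oddCfc f z = a * z := by
  have hslope : ContinuousOn (dslope f 0) (spectrum ℝ (offDiag z)) :=
    ((continuousOn_dslope hs).mpr ⟨hf, hf'⟩).mono hz
  have hmul : cfc f (offDiag z) = cfc (dslope f 0) (offDiag z) * offDiag z := by
    have hid := cfc_mul (dslope f 0) id (offDiag z) hslope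
    rw [cfc_id ℝ _ (isSelfAdjoint_offDiag z)] at hid
    rw [← hid]
    refine cfc_congr fun x _ => ?_
    simpa [h0, mul_comm] using (sub_smul_dslope f 0 x).symm
  exact ⟨(cfc (dslope f 0) (offDiag z)).entry 1 1, by
    rw [oddCfc, hmul, entry_mul]
    simp [offDiag_apply]⟩

end OddCalculus

/-! ### The geodesics through the origin -/

section GeodesicsThroughZero

variable {A : Type*} [CStarAlgebra A] [PartialOrder A] [StarOrderedRing A]

open MatrixTwo

lemma norm_oddCfc_tanh_lt_one (v : A) : ‖oddCfc Real.tanh v‖ < 1 :=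
  (norm_entry_le _ 1 0).trans_lt (norm_cfc_tanh_lt_one _)

lemma diskEmbedding_oddCfc_tanh (v : A) :
    diskEmbedding (oddCfc Real.tanh v) = NormedSpace.exp ((-2 : ℝ) • offDiag v) := by
  rw [diskEmbedding_eq_cayley (norm_oddCfc_tanh_lt_one v), offDiag_oddCfc Real.tanh_neg,
    cayley_cfc_tanh (isSelfAdjoint_offDiag v)]

lemma exists_oddCfc_tanh_eq_mul (v : A) : ∃ a : A, oddCfc Real.tanh v = a * v :=
  exists_oddCfc_eq_mul univ_mem (Set.subset_univ _) differentiable_tanh.continuous.continuousOn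
    (differentiable_tanh 0) Real.tanh_zero

lemma exists_oddCfc_artanh_eq_mul {z : A} (hz : ‖z‖ < 1) :
    ∃ a : A, oddCfc Real.artanh z = a * z :=
  exists_oddCfc_eq_mul (Ioo_mem_nhds neg_one_lt_zero one_pos)
    (spectrum_subset_Ioo_of_norm_lt_one (norm_offDiag_lt_one hz))
    (fun _ hx => (differentiableAt_artanh hx).continuousAt.continuousWithinAt)
    (differentiableAt_artanh ⟨neg_one_lt_zero, one_pos⟩) Real.artanh_zero

lemma oddCfc_tanh_oddCfc_artanh {z : A} (hz : ‖z‖ < 1) :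
    oddCfc Real.tanh (oddCfc Real.artanh z) = z := by
  have hspec := spectrum_subset_Ioo_of_norm_lt_one (norm_offDiag_lt_one hz)
  rw [oddCfc_oddCfc artanh_neg_eq_neg differentiable_tanh.continuous.continuousOn
    fun x hx => (differentiableAt_artanh (hspec hx)).continuousAt.continuousWithinAt]
  exact oddCfc_eq_self fun x hx => Real.tanh_artanh (hspec hx)

/-- The geodesic `t ↦ tanh (t artanh z)` of the disk, which starts at `0` and passes through `z`
at `t = 1`. -/
noncomputable def diskGeodesic (z : A) (t : ℝ) : A :=
  oddCfc Real.tanh (t • oddCfc Real.artanh z)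

lemma diskGeodesic_zero (z : A) : diskGeodesic z 0 = 0 := by
  obtain ⟨a, ha⟩ := exists_oddCfc_tanh_eq_mul ((0 : ℝ) • oddCfc Real.artanh z)
  rw [diskGeodesic, ha, zero_smul, mul_zero]

lemma diskGeodesic_one {z : A} (hz : ‖z‖ < 1) : diskGeodesic z 1 = z := by
  rw [diskGeodesic, one_smul, oddCfc_tanh_oddCfc_artanh hz]

lemma diskGeodesic_neg (z : A) (t : ℝ) : diskGeodesic z (-t) = -diskGeodesic z t := by
  rw [diskGeodesic, neg_smul,
    oddCfc_neg Real.tanh_neg differentiable_tanh.continuous.continuousOn, diskGeodesic]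

lemma norm_diskGeodesic_lt_one (z : A) (t : ℝ) : ‖diskGeodesic z t‖ < 1 :=
  norm_oddCfc_tanh_lt_one _

lemma diskEmbedding_diskGeodesic (z : A) (t : ℝ) :
    diskEmbedding (diskGeodesic z t) =
      NormedSpace.exp (t • (-2 : ℝ) • offDiag (oddCfc Real.artanh z)) := by
  rw [diskGeodesic, diskEmbedding_oddCfc_tanh, map_smul, smul_comm]

lemma contDiff_diskGeodesic {n : WithTop ℕ∞} (z : A) : ContDiff ℝ n (diskGeodesic z) := by
  have hlt (t : ℝ) : IsUnit (1 + offDiag (diskGeodesic z t)) :=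
    isUnit_one_add_of_norm_lt_one (norm_offDiag_lt_one (norm_diskGeodesic_lt_one z t))
  have hcayley : diskGeodesic z = fun t : ℝ => lowerLeft
      (cayley (NormedSpace.exp (t • (-2 : ℝ) • offDiag (oddCfc Real.artanh z)))) := by
    funext t
    rw [← diskEmbedding_diskGeodesic, cayley_diskEmbedding (norm_diskGeodesic_lt_one z t)]
    rfl
  rw [hcayley]
  refine ContDiff.continuousLinearMap_comp _ (contDiff_cayley (contDiff_exp_smul _) fun t => ?_)
  rw [← diskEmbedding_diskGeodesic, diskEmbedding_eq_cayley (norm_diskGeodesic_lt_one z t)]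
  exact isUnit_one_add_cayley isUnit_two (hlt t)

lemma isGeodesic_diskGeodesic (z : A) : IsGeodesic (diskGeodesic z) where
  norm_lt_one := norm_diskGeodesic_lt_one z
  contDiff := contDiff_diskGeodesic z
  geodesic_equation := by
    have h := satisfiesGeodesicEquation_exp_smul ((-2 : ℝ) • offDiag (oddCfc Real.artanh z))
    rwa [← funext (diskEmbedding_diskGeodesic z)] at h

lemma IsGeodesic.eq_diskGeodesic {z : A} (hz : ‖z‖ < 1) {δ : ℝ → A} (hδ : IsGeodesic δ)
    (h0 : δ 0 = 0) (h1 : δ 1 = z) : δ = diskGeodesic z :=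
  hδ.eq_of_eq_zero (isGeodesic_diskGeodesic z) h0 (diskGeodesic_zero z)
    (h1.trans (diskGeodesic_one hz).symm)

theorem existsUnique_isGeodesic {z : A} (hz : ‖z‖ < 1) :
    ∃! δ : ℝ → A, IsGeodesic δ ∧ δ 0 = 0 ∧ δ 1 = z :=
  ⟨diskGeodesic z, ⟨isGeodesic_diskGeodesic z, diskGeodesic_zero z, diskGeodesic_one hz⟩,
    fun _ ⟨hδ, h0, h1⟩ => hδ.eq_diskGeodesic hz h0 h1⟩

lemma exists_diskGeodesic_eq_mul {z : A} (hz : ‖z‖ < 1) (t : ℝ) :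
    ∃ a : A, diskGeodesic z t = a * z := by
  obtain ⟨b, hb⟩ := exists_oddCfc_artanh_eq_mul hz
  obtain ⟨a, ha⟩ := exists_oddCfc_tanh_eq_mul (t • oddCfc Real.artanh z)
  exact ⟨t • (a * b), by
    rw [diskGeodesic, ha, hb, mul_smul_comm, smul_mul_assoc, mul_assoc]⟩

lemma norm_oddCfc_tanh_smul_mul_abs_sub_le (v : A) {t : ℝ} (ht : 0 < t) :
    ‖oddCfc Real.tanh (t • v) * CFC.abs (oddCfc Real.tanh v) - oddCfc Real.tanh v‖ ≤ 2 / t := by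
  have hv := isSelfAdjoint_offDiag v
  have htanh := differentiable_tanh.continuous
  have hcfc : cfc Real.tanh (offDiag (t • v)) * CFC.abs (cfc Real.tanh (offDiag v)) -
      cfc Real.tanh (offDiag v) =
      cfc (fun y => Real.tanh (t * y) * |Real.tanh y| - Real.tanh y) (offDiag v) := by
    rw [map_smul, ← cfc_comp_smul t Real.tanh _ htanh.continuousOn,
      CFC.abs_eq_cfc_norm _ (cfc_predicate _ _), ← cfc_comp' .., ← cfc_mul .., ← cfc_sub ..]
    rfl
  have hentry : oddCfc Real.tanh (t • v) * CFC.abs (oddCfc Real.tanh v) - oddCfc Real.tanh v =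
      (cfc Real.tanh (offDiag (t • v)) * CFC.abs (cfc Real.tanh (offDiag v)) -
        cfc Real.tanh (offDiag v)).entry 1 0 := by
    rw [← offDiag_oddCfc Real.tanh_neg v, abs_offDiag, entry_sub, entry_mul]
    simp [diag_apply, oddCfc]
  rw [hentry, hcfc]
  exact (norm_entry_le _ 1 0).trans <| norm_cfc_le (by positivity) fun y _ =>
    abs_tanh_mul_abs_tanh_sub_le ht y

lemma norm_diskGeodesic_mul_abs_sub_le {z : A} (hz : ‖z‖ < 1) {t : ℝ} (ht : 0 < t) :
    ‖diskGeodesic z t * CFC.abs z - z‖ ≤ 2 / t := by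
  simpa only [diskGeodesic, oddCfc_tanh_oddCfc_artanh hz] using
    norm_oddCfc_tanh_smul_mul_abs_sub_le (oddCfc Real.artanh z) ht

end GeodesicsThroughZero

/-! ### Polar decomposition of bounded operators -/

section PolarDecomposition

variable {H : Type*} [NormedAddCommGroup H] [InnerProductSpace ℂ H] [CompleteSpace H]
  {T : H →L[ℂ] H}

lemma adjoint_abs (T : H →L[ℂ] H) : ContinuousLinearMap.adjoint (CFC.abs T) = CFC.abs T :=
  (IsSelfAdjoint.of_nonneg (CFC.abs_nonneg T)).star_eq

lemma abs_apply_abs_apply (T : H →L[ℂ] H) (x : H) :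
    CFC.abs T (CFC.abs T x) = ContinuousLinearMap.adjoint T (T x) :=
  DFunLike.congr_fun (CFC.abs_mul_abs T) x

lemma norm_abs_apply (T : H →L[ℂ] H) (x : H) : ‖CFC.abs T x‖ = ‖T x‖ := by
  have h : inner ℂ (CFC.abs T x) (CFC.abs T x) = inner ℂ (T x) (T x) := by
    rw [← ContinuousLinearMap.adjoint_inner_right, adjoint_abs, abs_apply_abs_apply,
      ContinuousLinearMap.adjoint_inner_right]
  rw [@norm_eq_sqrt_re_inner ℂ, h, ← norm_eq_sqrt_re_inner]

lemma abs_apply_eq_zero_iff {x : H} : CFC.abs T x = 0 ↔ T x = 0 := by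
  rw [← norm_eq_zero, norm_abs_apply, norm_eq_zero]

lemma mem_orthogonal_range_abs_iff {x : H} : x ∈ (CFC.abs T).rangeᗮ ↔ T x = 0 := by
  rw [ContinuousLinearMap.orthogonal_range, adjoint_abs]
  exact abs_apply_eq_zero_iff

lemma mem_of_range_abs_of_ker {S : Submodule ℂ H} (hS : IsClosed (S : Set H))
    (hrange : ∀ x, CFC.abs T x ∈ S) (hker : ∀ x, T x = 0 → x ∈ S) (x : H) : x ∈ S := by
  have hbot : Sᗮ = ⊥ := by
    refine (Submodule.eq_bot_iff _).mpr fun y hy => ?_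
    have hrange' : (CFC.abs T).range ≤ S := by
      rintro _ ⟨w, rfl⟩
      exact hrange w
    have hyS : y ∈ S := hker y <| mem_orthogonal_range_abs_iff.mp <|
      Submodule.orthogonal_le hrange' hy
    exact inner_self_eq_zero.mp (hy y hyS)
  have htop := Submodule.topologicalClosure_eq_top_iff.mpr hbot
  rw [hS.submodule_topologicalClosure_eq] at htop
  exact htop ▸ Submodule.mem_top

lemma eq_of_eq_on_range_abs_of_ker {R S : H →L[ℂ] H}
    (hrange : ∀ x, R (CFC.abs T x) = S (CFC.abs T x))
    (hker : ∀ x, T x = 0 → R x = S x) : R = S :=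
  ContinuousLinearMap.ext <|
    mem_of_range_abs_of_ker (T := T) (S := LinearMap.eqLocus R.toLinearMap S.toLinearMap)
      (isClosed_eq R.continuous S.continuous) hrange hker

lemma tendsto_of_range_abs_of_ker {ι : Type*} {l : Filter ι} {F : ι → H →L[ℂ] H} {f : H →L[ℂ] H}
    {C : ℝ} (hF : ∀ i, ‖F i‖ ≤ C)
    (hrange : ∀ x, Tendsto (fun i => F i (CFC.abs T x)) l (𝓝 (f (CFC.abs T x))))
    (hker : ∀ x, T x = 0 → Tendsto (fun i => F i x) l (𝓝 (f x))) (x : H) :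
    Tendsto (fun i => F i x) l (𝓝 (f x)) := by
  let S : Submodule ℂ H :=
    { carrier := {x | Tendsto (fun i => F i x) l (𝓝 (f x))}
      add_mem' := fun ha hb => by simpa using Tendsto.add ha hb
      zero_mem' := by simpa using tendsto_const_nhds
      smul_mem' := fun c _ ha => by simpa using Tendsto.const_smul ha c }
  have hequi : Equicontinuous fun i => (F i : H → H) :=
    (LipschitzWith.uniformEquicontinuous _ C.toNNReal fun i =>
      (F i).lipschitz.weaken (NNReal.le_toNNReal_of_coe_le (hF i))).equicontinuous
  exact mem_of_range_abs_of_ker (T := T) (S := S)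
    (hequi.isClosed_setOfPred_tendsto f.continuous) hrange hker x

namespace IsPolarPart

variable {ω : H →L[ℂ] H}

lemma apply_abs (h : IsPolarPart T ω) (x : H) : ω (CFC.abs T x) = T x :=
  DFunLike.congr_fun h.eq_mul_abs.symm x

lemma apply_eq_zero (h : IsPolarPart T ω) {x : H} (hx : T x = 0) : ω x = 0 :=
  h.ker_eq.ge hx

lemma unique {ω' : H →L[ℂ] H} (h : IsPolarPart T ω) (h' : IsPolarPart T ω') : ω = ω' :=
  eq_of_eq_on_range_abs_of_ker (T := T) (fun x => by rw [h.apply_abs, h'.apply_abs])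
    fun x hx => by rw [h.apply_eq_zero hx, h'.apply_eq_zero hx]

lemma commute (h : IsPolarPart T ω) {g : H →L[ℂ] H} (hT : Commute g T)
    (hT' : Commute g (star T)) : Commute g ω := by
  have happly (x : H) : g (T x) = T (g x) := DFunLike.congr_fun hT.eq x
  have habs (x : H) : g (CFC.abs T x) = CFC.abs T (g x) :=
    DFunLike.congr_fun (hT.symm.cfcAbs_left (commute_star_comm.mp hT'.symm)).symm.eq x
  refine eq_of_eq_on_range_abs_of_ker (T := T) (fun x => ?_) fun x hx => ?_
  · calc g (ω (CFC.abs T x)) = T (g x) := by rw [h.apply_abs, happly]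
      _ = ω (g (CFC.abs T x)) := by rw [habs, h.apply_abs]
  · have hgx : T (g x) = 0 := by rw [← happly, hx, map_zero]
    change g (ω x) = ω (g x)
    rw [h.apply_eq_zero hx, h.apply_eq_zero hgx, map_zero]

lemma mem_centralizer_centralizer (h : IsPolarPart T ω) {s : Set (H →L[ℂ] H)} (hT : T ∈ s) :
    ω ∈ StarSubalgebra.centralizer ℂ (StarSubalgebra.centralizer ℂ s : Set (H →L[ℂ] H)) := by
  have hcomm {g : H →L[ℂ] H} (hg : g ∈ StarSubalgebra.centralizer ℂ s) : Commute g ω := by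
    obtain ⟨h₁, h₂⟩ := (StarSubalgebra.mem_centralizer_iff ℂ).mp hg T hT
    exact h.commute h₁.symm h₂.symm
  exact (StarSubalgebra.mem_centralizer_iff ℂ).mpr fun g hg =>
    ⟨hcomm hg, hcomm (star_mem hg)⟩

end IsPolarPart

lemma star_mul_eq_abs_of_apply {ω : H →L[ℂ] H} (habs : ∀ x, ω (CFC.abs T x) = T x)
    (hker : ∀ x, T x = 0 → ω x = 0) : star T * ω = CFC.abs T := by
  refine eq_of_eq_on_range_abs_of_ker (T := T) (fun x => ?_) fun x hx => ?_
  · change star T (ω (CFC.abs T x)) = _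
    rw [habs, abs_apply_abs_apply, ContinuousLinearMap.star_eq_adjoint]
  · change star T (ω x) = _
    rw [hker x hx, map_zero, abs_apply_eq_zero_iff.mpr hx]

lemma isPolarPart_of_apply {ω : H →L[ℂ] H} (habs : ∀ x, ω (CFC.abs T x) = T x)
    (hker : ∀ x, T x = 0 → ω x = 0) : IsPolarPart T ω := by
  have hleft := star_mul_eq_abs_of_apply habs hker
  have hright : star ω * T = CFC.abs T := by
    rw [← star_star (star ω * T), star_mul, star_star, hleft]
    exact adjoint_abs T
  refine ⟨?_, ContinuousLinearMap.ext fun x => (habs x).symm, ?_⟩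
  · refine eq_of_eq_on_range_abs_of_ker (T := T) (fun x => ?_) fun x hx => ?_
    · change ω (star ω (ω (CFC.abs T x))) = _
      rw [habs]
      exact (congrArg ω (DFunLike.congr_fun hright x)).trans (habs x)
    · change ω (star ω (ω x)) = _
      rw [hker x hx, map_zero, map_zero]
  · ext x
    refine ⟨fun hx => abs_apply_eq_zero_iff.mp ?_, hker x⟩
    have hωx : ω x = 0 := hx
    rw [← hleft, mul_apply_eq_comp, hωx, map_zero]

lemma exists_apply_abs_eq (T : H →L[ℂ] H) : ∃ ω : H →L[ℂ] H,
    (∀ x, ω (CFC.abs T x) = T x) ∧ ∀ x, T x = 0 → ω x = 0 := by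
  let K := (CFC.abs T).range.topologicalClosure
  have hmem (x : H) : CFC.abs T x ∈ K := Submodule.le_topologicalClosure _ ⟨x, rfl⟩
  let e : H →ₗ[ℂ] K := (CFC.abs T).toLinearMap.codRestrict K hmem
  have hdense : DenseRange e := by
    rw [DenseRange, Subtype.dense_iff, ← Set.range_comp]
    exact subset_rfl
  refine ⟨(T.toLinearMap.extendOfNorm e).comp K.orthogonalProjectionOnto, fun x => ?_,
    fun x hx => ?_⟩
  · have hproj : K.orthogonalProjectionOnto (CFC.abs T x) = e x :=
      K.orthogonalProjectionOnto_mem_subspace_eq_self (e x)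
    rw [ContinuousLinearMap.comp_apply, hproj]
    exact LinearMap.extendOfNorm_eq hdense ⟨1, fun y => by
      rw [one_mul]; exact (norm_abs_apply T y).ge⟩ x
  · have hproj : K.orthogonalProjectionOnto x = 0 := by
      rw [Submodule.orthogonalProjectionOnto_eq_zero_iff, Submodule.orthogonal_closure]
      exact mem_orthogonal_range_abs_iff.mpr hx
    rw [ContinuousLinearMap.comp_apply, hproj, map_zero]

theorem existsUnique_isPolarPart {s : Set (H →L[ℂ] H)} (hT : T ∈ s) :
    ∃! ω : H →L[ℂ] H,
      ω ∈ StarSubalgebra.centralizer ℂ (StarSubalgebra.centralizer ℂ s : Set (H →L[ℂ] H)) ∧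
        IsPolarPart T ω := by
  obtain ⟨ω, habs, hker⟩ := exists_apply_abs_eq T
  have hω := isPolarPart_of_apply habs hker
  exact ⟨ω, ⟨hω.mem_centralizer_centralizer hT, hω⟩, fun ω' hω' => hω'.2.unique hω⟩

end PolarDecomposition

/-! ### Limit points of geodesics -/

section LimitPoints

lemma sotTendsto_iff {ι H : Type*} [NormedAddCommGroup H] [InnerProductSpace ℂ H]
    {T : ι → H →L[ℂ] H} {l : Filter ι} {S : H →L[ℂ] H} :
    SOTTendsto T l S ↔ ∀ x, Tendsto (fun i => T i x) l (𝓝 (S x)) :=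
  PointwiseConvergenceCLM.tendsto_iff_forall_tendsto

variable {A : Type*} [CStarAlgebra A] [PartialOrder A] [StarOrderedRing A]
  {H : Type*} [NormedAddCommGroup H] [InnerProductSpace ℂ H] [CompleteSpace H]
  (π : A →⋆ₐ[ℂ] (H →L[ℂ] H))

lemma abs_map_starAlgHom (z : A) : CFC.abs (π z) = π (CFC.abs z) :=
  CFC.sqrt_unique (by rw [← map_mul, CFC.abs_mul_abs, map_mul, map_star])
    (map_nonneg π (CFC.abs_nonneg z))

lemma norm_map_diskGeodesic_le (z : A) (t : ℝ) : ‖π (diskGeodesic z t)‖ ≤ 1 :=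
  (NonUnitalStarAlgHom.norm_apply_le π _).trans (norm_diskGeodesic_lt_one z t).le

lemma map_diskGeodesic_apply_eq_zero {z : A} (hz : ‖z‖ < 1) (t : ℝ) {x : H} (hx : π z x = 0) :
    π (diskGeodesic z t) x = 0 := by
  obtain ⟨a, ha⟩ := exists_diskGeodesic_eq_mul hz t
  rw [ha, map_mul, mul_apply_eq_comp, hx, map_zero]

lemma tendsto_map_diskGeodesic_abs {z : A} (hz : ‖z‖ < 1) (x : H) :
    Tendsto (fun t => π (diskGeodesic z t) (CFC.abs (π z) x)) atTop (𝓝 (π z x)) := by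
  have hbound {t : ℝ} (ht : 0 < t) :
      ‖π (diskGeodesic z t) (CFC.abs (π z) x) - π z x‖ ≤ 2 / t * ‖x‖ :=
    calc ‖π (diskGeodesic z t) (CFC.abs (π z) x) - π z x‖
      _ = ‖π (diskGeodesic z t * CFC.abs z - z) x‖ := by
        rw [abs_map_starAlgHom, map_sub, map_mul]; rfl
      _ ≤ ‖diskGeodesic z t * CFC.abs z - z‖ * ‖x‖ :=
        (π _).le_of_opNorm_le (NonUnitalStarAlgHom.norm_apply_le π _) x
      _ ≤ 2 / t * ‖x‖ := by gcongr; exact norm_diskGeodesic_mul_abs_sub_le hz ht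
  have hzero : Tendsto (fun t : ℝ => 2 / t * ‖x‖) atTop (𝓝 0) := by
    simpa using (tendsto_const_nhds.div_atTop tendsto_id).mul_const ‖x‖
  exact tendsto_iff_norm_sub_tendsto_zero.mpr <| squeeze_zero' (.of_forall fun _ => norm_nonneg _)
    ((eventually_gt_atTop 0).mono fun _ => hbound) hzero

theorem sotTendsto_map_diskGeodesic_atTop {z : A} (hz : ‖z‖ < 1) {ω : H →L[ℂ] H}
    (hω : IsPolarPart (π z) ω) : SOTTendsto (fun t => π (diskGeodesic z t)) atTop ω := by
  refine sotTendsto_iff.mpr <| tendsto_of_range_abs_of_ker (T := π z)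
    (norm_map_diskGeodesic_le π z) (fun x => ?_) fun x hx => ?_
  · rw [hω.apply_abs]
    exact tendsto_map_diskGeodesic_abs π hz x
  · simp only [map_diskGeodesic_apply_eq_zero π hz _ hx, hω.apply_eq_zero hx]
    exact tendsto_const_nhds

theorem sotTendsto_map_diskGeodesic_atBot {z : A} (hz : ‖z‖ < 1) {ω : H →L[ℂ] H}
    (hω : IsPolarPart (π z) ω) : SOTTendsto (fun t => π (diskGeodesic z t)) atBot (-ω) := by
  have htop := sotTendsto_iff.mp (sotTendsto_map_diskGeodesic_atTop π hz hω)
  refine sotTendsto_iff.mpr fun x =>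
    ((htop x).comp tendsto_neg_atBot_atTop).neg.congr fun t => ?_
  simp only [Function.comp_apply, diskGeodesic_neg, map_neg, neg_apply, neg_neg]

end LimitPoints

end PoincareDisk

theorem theorem7p1_general {A : Type*} [CStarAlgebra A] [PartialOrder A] [StarOrderedRing A]
    {H : Type*} [NormedAddCommGroup H] [InnerProductSpace ℂ H] [CompleteSpace H]
    (π : A →⋆ₐ[ℂ] (H →L[ℂ] H)) (z : A) (hz : ‖z‖ < 1) :
    (∃! δ : ℝ → A, PoincareDisk.IsGeodesic δ ∧ δ 0 = 0 ∧ δ 1 = z) ∧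
    (∃! ω : H →L[ℂ] H,
      ω ∈ StarSubalgebra.centralizer ℂ
          (StarSubalgebra.centralizer ℂ (Set.range π) : Set (H →L[ℂ] H)) ∧
        PoincareDisk.IsPolarPart (π z) ω) ∧
    ∀ δ : ℝ → A, PoincareDisk.IsGeodesic δ → δ 0 = 0 → δ 1 = z →
      ∀ ω : H →L[ℂ] H, PoincareDisk.IsPolarPart (π z) ω →
        PoincareDisk.SOTTendsto (fun t => π (δ t)) atTop ω ∧
        PoincareDisk.SOTTendsto (fun t => π (δ t)) atBot (-ω) := by
  refine ⟨PoincareDisk.existsUnique_isGeodesic hz,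
    PoincareDisk.existsUnique_isPolarPart (Set.mem_range_self z), fun δ hδ h0 h1 ω hω => ?_⟩
  rw [hδ.eq_diskGeodesic hz h0 h1]
  exact ⟨PoincareDisk.sotTendsto_map_diskGeodesic_atTop π hz hω,
    PoincareDisk.sotTendsto_map_diskGeodesic_atBot π hz hω⟩

theorem theorem7p1 {A : Type*} [CStarAlgebra A] [PartialOrder A] [StarOrderedRing A]
    (z : A) (hz : ‖z‖ < 1) :
    (∃! δ : ℝ → A, PoincareDisk.IsGeodesic δ ∧ δ 0 = 0 ∧ δ 1 = z) ∧
    (∃! ω : PoincareDisk.UniversalSpace A →L[ℂ] PoincareDisk.UniversalSpace A,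
      ω ∈ PoincareDisk.enveloping A ∧
      PoincareDisk.IsPolarPart (PoincareDisk.universalRep A z) ω) ∧
    ∀ δ : ℝ → A, PoincareDisk.IsGeodesic δ → δ 0 = 0 → δ 1 = z →
      ∀ ω ∈ PoincareDisk.enveloping A,
        PoincareDisk.IsPolarPart (PoincareDisk.universalRep A z) ω →
          PoincareDisk.SOTTendsto (fun t => PoincareDisk.universalRep A (δ t)) atTop ω ∧
          PoincareDisk.SOTTendsto (fun t => PoincareDisk.universalRep A (δ t)) atBot (-ω) := by
  obtain ⟨hgeodesic, hpolar, hlimit⟩ :=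
    theorem7p1_general (PoincareDisk.universalRep A) z hz
  exact ⟨hgeodesic, hpolar, fun δ hδ h0 h1 ω _ => hlimit δ hδ h0 h1 ω⟩
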